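/- There are absolute constants $c,C>0$ such that the following holds for all parameters and all datasets. Let $D=\{(x^{(i)},y^{(i)})\}_{i=1}^n$ be a dataset with $x^{(i)}\in\mathbb{R}^d$, $\|x^{(i)}\|_2\le B_2$, and $y^{(i)}\in[-B_1,B_1]$. Let $\gamma>0$ be such that $$\inf_{r\in\mathbb{R}^d}\ \sum_{i=1}^n\bigl(y^{(i)}-r^{\mathsf T}x^{(i)}\bigr)^2\ \ge\ \gamma n .$$ Let $Q=\frac1n\sum_{i=1}^n x^{(i)}x^{(i)\mathsf T}$, assume $Q\neq0$, and let $\lambda^*$ be the smallest nonzero eigenvalue of $Q$. Let $m,k$ be positive integers with $mk\le n$, and let $S_1,\dots,S_m\subseteq[n]$ be random pairwise disjoint bags of size $k$, obtained by sampling $mk$ indices uniformly without replacement (so $(S_1,\dots,S_m)$ is uniform over all sequences of $m$ pairwise disjoint $k$-subsets of $[n]$). Then, with probability at least $1-\delta_2$ over $S_1,\dots,S_m$, $$\sum_{i\in S_j}\bigl(y^{(i)}-r^{\mathsf T}x^{(i)}\bigr)^2\ \ge\ \frac{k\gamma}{4}\qquad\text{for all } j\in[m] \text{ and all } r\in\mathbb{R}^d$$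 (simultaneously), where $$\delta_2=\exp\left(-c\,\frac{k\lambda^{*2}\gamma^2}{B_1^4B_2^4}+C\left(d\log\frac{3B_1^2B_2^2}{\gamma\lambda^*}+\log m\right)\right).$$ If moreover $\gamma\le B_1^2/3$ and $\gamma\lambda^*\le1$, the same holds, with the same $c$ and $C$, for $$\delta_2=\exp\left(-c\,\frac{k\lambda^{*2}\gamma^2}{B_1^4B_2^4}+C\left(d\log\frac{B_1B_2}{\gamma\lambda^*}+\log m\right)\right).$$ -/

import Mathlib

open MeasureTheory ProbabilityTheory

noncomputable section

/-- A dataset of `n` labelled points: feature vectors in `ℝ^d` and real labels. -/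
structure RegressionData (n d : ℕ) where
  x : Fin n → EuclideanSpace ℝ (Fin d)
  y : Fin n → ℝ

namespace RegressionData

variable {n d : ℕ}

/-- The squared loss of the linear regressor `z ↦ rᵀ z`, summed over the points with index in `T`. -/
def loss (D : RegressionData n d) (T : Finset (Fin n)) (r : EuclideanSpace ℝ (Fin d)) : ℝ :=
  ∑ i ∈ T, (D.y i - inner ℝ r (D.x i)) ^ 2

/-- The optimal linear regression loss on the whole dataset,
`inf_r ∑_{i=1}^n (y_i - rᵀ x_i)²`, the infimum being over all `r ∈ ℝ^d`. -/
def opt (D : RegressionData n d) : ℝ :=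
  ⨅ r : EuclideanSpace ℝ (Fin d), D.loss Finset.univ r

/-- The empirical second-moment matrix `Q = (1/n) ∑_{i=1}^n x_i x_iᵀ`. -/
def Q (D : RegressionData n d) : Matrix (Fin d) (Fin d) ℝ :=
  (n : ℝ)⁻¹ • ∑ i, Matrix.vecMulVec (D.x i) (D.x i)

/-- `lam` is the smallest nonzero eigenvalue of `Q`
(which is positive semidefinite, so that its nonzero eigenvalues are positive). -/
def IsMinNonzeroEigenvalue (D : RegressionData n d) (lam : ℝ) : Prop :=
  IsLeast {μ : ℝ | μ ≠ 0 ∧ Module.End.HasEigenvalue (Matrix.toLin' D.Q) μ} lam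

end RegressionData

/-- The sequences `(S_1, …, S_m)` of pairwise disjoint bags `S_j ⊆ {1, …, n}` of size `k`. -/
def bagFamilies (n m k : ℕ) : Set (Fin m → Finset (Fin n)) :=
  {S | (∀ j, (S j).card = k) ∧ Pairwise fun j j' => Disjoint (S j) (S j')}

/-- The law of the random bags `(S_1, …, S_m)`: the `m * k` indices are sampled without
replacement, so the law is uniform on the sequences of `m` pairwise disjoint bags of size `k`. -/
def bagLaw (n m k : ℕ) : Measure (Fin m → Finset (Fin n)) :=
  uniformOn (bagFamilies n m k)

end

/-!
For a single regressor `r` the loss of a random bag is a sum, sampled without replacement, of the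
numbers `(y i - ⟪r, x i⟫)²`. Its lower tail obeys a Hoeffding bound: by Maclaurin's inequality
(`sum_powersetCard_prod_le`) the Laplace transform of such a sum is at most the one for independent
samples (`card_powersetCard_sum_le_le`).

The regressors are unbounded, and the smallest nonzero eigenvalue `lam` of `Q` reduces them to a
ball. A regressor may be projected to the range of `Q` without changing its predictions, and there
the mean of `⟪r, x i⟫²` is at least `lam * ‖r‖²`
(`RegressionData.IsMinNonzeroEigenvalue.exists_inner_eq_and_le`). On the sphere of radius
`R = B₁ √(6 / lam)` the mean loss is therefore at least `2 B₁²`, while the loss at `0` is at most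
`B₁²`. A bag whose loss is close to its mean on the ball of radius `R` then has loss at least `B₁²`
per point on the sphere, and convexity along rays extends this bound to the outside of the ball
(`RegressionData.le_loss_of_net`). No concentration of the second-moment matrix of the bag is
needed.

On the ball the loss per point is bounded by a multiple of `B₁² B₂² / lam` and is Lipschitz, so a
net of at most `exp (6 d log (3 B₁² B₂² / (γ lam)))` points suffices (`exists_net_closedBall`). A union
bound over the net controls one bag (`RegressionData.card_filter_exists_loss_lt_le`), and since each
bag is a uniformly random `k`-subset (`bagLaw_real_le_of_card_le`), a union bound over the `m` bags
gives the first estimate. The second follows from it, because with `Y = B₁ B₂ / (γ lam)` its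
additional assumptions give `3 B₁² B₂² / (γ lam) ≤ Y ^ 4`.
-/

/-! ### Sums over subsets of a fixed size -/

lemma sum_sum_powersetCard_erase {ι : Type*} [Fintype ι] [DecidableEq ι] (k : ℕ)
    (F : Finset ι → ℝ) :
    ∑ j, ∑ S ∈ (Finset.univ.erase j).powersetCard k, F S
      = ((Fintype.card ι : ℝ) - k) * ∑ S ∈ (Finset.univ : Finset ι).powersetCard k, F S := by
  rw [Finset.sum_comm' (t' := (Finset.univ : Finset ι).powersetCard k) (s' := fun S => Sᶜ)]
  · rw [Finset.mul_sum]
    refine Finset.sum_congr rfl fun S hS => ?_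
    rw [Finset.mem_powersetCard] at hS
    rw [Finset.sum_const, nsmul_eq_mul, Finset.card_compl, Nat.cast_sub (Finset.card_le_univ S),
      hS.2]
  · intro j S
    simp only [Finset.mem_univ, Finset.mem_powersetCard, true_and, Finset.subset_univ,
      Finset.mem_compl]
    refine and_congr_left fun _ => ⟨fun h hj => by simpa using h hj, fun h x hx => ?_⟩
    refine Finset.mem_erase.2 ⟨?_, Finset.mem_univ x⟩
    rintro rfl
    exact h hx

lemma sum_powersetCard_succ_erase {ι : Type*} [DecidableEq ι] (A : Finset ι) {j : ι} (hj : j ∈ A)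
    (k : ℕ) (z : ι → ℝ) :
    ∑ S ∈ A.powersetCard (k + 1), ∏ i ∈ S, z i
      = ∑ S ∈ (A.erase j).powersetCard (k + 1), ∏ i ∈ S, z i
        + z j * ∑ S ∈ (A.erase j).powersetCard k, ∏ i ∈ S, z i := by
  have hnot : ∀ {l : ℕ} {S : Finset ι}, S ∈ (A.erase j).powersetCard l → j ∉ S := fun hS hjS => by
    simpa using (Finset.mem_powersetCard.1 hS).1 hjS
  conv_lhs => rw [← Finset.insert_erase hj]
  rw [Finset.powersetCard_succ_insert (Finset.notMem_erase j A), Finset.sum_union, Finset.sum_image]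
  · rw [Finset.mul_sum]
    congr 1
    exact Finset.sum_congr rfl fun S hS => Finset.prod_insert (hnot hS)
  · intro S hS T hT h
    rw [← Finset.erase_insert (hnot hS), ← Finset.erase_insert (hnot hT), h]
  · rw [Finset.disjoint_left]
    intro S hS hS'
    obtain ⟨T, -, rfl⟩ := Finset.mem_image.1 hS'
    exact hnot hS (Finset.mem_insert_self j T)

/-- The elementary symmetric polynomial of degree `k` in all variables but `z j` decreases as
`z j` grows, because removing the larger of two variables leaves the smaller one. -/
lemma antivary_sum_powersetCard_erase {ι : Type*} [Fintype ι] [DecidableEq ι] {z : ι → ℝ}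
    (hz : ∀ i, 0 ≤ z i) (k : ℕ) :
    Antivary z fun j => ∑ S ∈ (Finset.univ.erase j).powersetCard k, ∏ i ∈ S, z i := by
  intro i j hij
  dsimp only at hij
  by_contra! hlt
  rcases k with _ | k
  · simp at hij
  have hne : i ≠ j := by
    rintro rfl
    exact lt_irrefl _ hlt
  rw [sum_powersetCard_succ_erase (Finset.univ.erase i) (j := j) (by simp [hne.symm]),
    sum_powersetCard_succ_erase (Finset.univ.erase j) (j := i) (by simp [hne]),
    Finset.erase_right_comm] at hij
  have h0 : 0 ≤ ∑ S ∈ ((Finset.univ.erase j).erase i).powersetCard k, ∏ l ∈ S, z l :=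
    Finset.sum_nonneg fun S _ => Finset.prod_nonneg fun l _ => hz l
  have := mul_le_mul_of_nonneg_right hlt.le h0
  linarith

/-- A weak form of Maclaurin's inequality: the mean of the products over `k`-subsets is at most
the `k`-th power of the mean. The step from `k` to `k + 1` is Chebyshev's sum inequality for `z j`
and the elementary symmetric polynomial in the remaining variables. -/
theorem sum_powersetCard_prod_le {ι : Type*} [Fintype ι] [Nonempty ι] {z : ι → ℝ}
    (hz : ∀ i, 0 ≤ z i) (k : ℕ) :
    ∑ S ∈ (Finset.univ : Finset ι).powersetCard k, ∏ i ∈ S, z i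
      ≤ (Fintype.card ι).choose k * ((∑ i, z i) / Fintype.card ι) ^ k := by
  classical
  set N : ℝ := (Fintype.card ι : ℝ) with hN
  have hNpos : 0 < N := Nat.cast_pos.2 Fintype.card_pos
  induction k with
  | zero => simp
  | succ k ih =>
    set E : ℕ → ℝ := fun l => ∑ S ∈ (Finset.univ : Finset ι).powersetCard l, ∏ i ∈ S, z i with hE
    have hsum : ∑ j, z j * ∑ S ∈ (Finset.univ.erase j).powersetCard k, ∏ i ∈ S, z i
        = (k + 1) * E (k + 1) := by
      have h : ∀ j, z j * ∑ S ∈ (Finset.univ.erase j).powersetCard k, ∏ i ∈ S, z i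
          = E (k + 1) - ∑ S ∈ (Finset.univ.erase j).powersetCard (k + 1), ∏ i ∈ S, z i := by
        intro j
        rw [hE]
        simp only
        rw [sum_powersetCard_succ_erase Finset.univ (Finset.mem_univ j)]
        ring
      rw [Finset.sum_congr rfl fun j _ => h j, Finset.sum_sub_distrib, sum_sum_powersetCard_erase]
      simp only [Finset.sum_const, Finset.card_univ, nsmul_eq_mul, hE]
      push_cast
      ring
    have hcheb := (antivary_sum_powersetCard_erase hz k).card_mul_sum_le_sum_mul_sum
    rw [hsum, sum_sum_powersetCard_erase] at hcheb
    have hchoose : ((Fintype.card ι).choose (k + 1) : ℝ) * (k + 1)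
        = (Fintype.card ι).choose k * (N - k) := by
      rcases le_or_gt k (Fintype.card ι) with hk | hk
      · rw [hN, ← Nat.cast_sub hk]
        exact_mod_cast Nat.choose_succ_right_eq (Fintype.card ι) k
      · rw [Nat.choose_eq_zero_of_lt hk, Nat.choose_eq_zero_of_lt (hk.trans (Nat.lt_succ_self k))]
        simp
    set w : ℝ := (∑ i, z i) / N with hw
    have hw0 : 0 ≤ w := div_nonneg (Finset.sum_nonneg fun i _ => hz i) hNpos.le
    have hwN : ∑ i, z i = w * N := by rw [hw]; field_simp
    rw [hwN] at hcheb
    have hstep : (k + 1) * E (k + 1) ≤ w * ((N - k) * E k) := by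
      refine le_of_mul_le_mul_left ?_ hNpos
      calc N * ((k + 1) * E (k + 1)) ≤ _ := hcheb
        _ = N * (w * ((N - k) * E k)) := by ring
    rcases le_or_gt k (Fintype.card ι) with hk | hk
    · have hk' : 0 ≤ N - k := by rw [sub_nonneg, hN]; exact_mod_cast hk
      refine le_of_mul_le_mul_left (a := (k + 1 : ℝ)) ?_ (by positivity)
      calc (k + 1) * E (k + 1) ≤ w * ((N - k) * E k) := hstep
        _ ≤ w * ((N - k) * ((Fintype.card ι).choose k * w ^ k)) := by gcongr
        _ = ((Fintype.card ι).choose k * (N - k)) * w ^ (k + 1) := by ring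
        _ = (k + 1) * ((Fintype.card ι).choose (k + 1) * w ^ (k + 1)) := by rw [← hchoose]; ring
    · rw [Finset.powersetCard_eq_empty.2 (by rw [Finset.card_univ]; omega), Finset.sum_empty]
      positivity

/-! ### Concentration for sampling without replacement -/

lemma exp_neg_le_quadratic {u : ℝ} (hu : 0 ≤ u) : Real.exp (-u) ≤ 1 - u + u ^ 2 / 2 := by
  have h := Real.quadratic_le_exp_of_nonneg hu
  have hpos : 0 < 1 + u + u ^ 2 / 2 := by positivity
  have hq : 0 < 1 - u + u ^ 2 / 2 := by nlinarith [sq_nonneg (u - 1)]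
  rw [Real.exp_neg, inv_le_comm₀ (Real.exp_pos u) hq]
  refine le_trans ?_ h
  rw [inv_le_iff_one_le_mul₀ hq]
  nlinarith [sq_nonneg (u ^ 2)]

/-- A lower-tail Hoeffding bound for a uniformly random `k`-subset, in counting form. Maclaurin's
inequality bounds the Laplace transform of the sum by the one for independent samples. -/
theorem card_powersetCard_sum_le_le {ι : Type*} [Fintype ι] [Nonempty ι] {a : ι → ℝ} {M : ℝ}
    (hM : 0 < M) (h0 : ∀ i, 0 ≤ a i) (hle : ∀ i, a i ≤ M) (k : ℕ) {t : ℝ} (ht : 0 ≤ t) :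
    (((Finset.univ : Finset ι).powersetCard k).filter
        fun S => ∑ i ∈ S, a i ≤ k * ((∑ i, a i) / Fintype.card ι - t)).card
      ≤ (Fintype.card ι).choose k * Real.exp (-(k * t ^ 2 / (2 * M ^ 2))) := by
  classical
  set N : ℝ := (Fintype.card ι : ℝ) with hN
  have hNpos : 0 < N := Nat.cast_pos.2 Fintype.card_pos
  set w : ℝ := (∑ i, a i) / N with hw
  -- the minimizer of the exponent `-s t + s ^ 2 M ^ 2 / 2`
  set s : ℝ := t / M ^ 2 with hs
  have hs0 : 0 ≤ s := by positivity
  have hmean : (∑ i, Real.exp (-(s * a i))) / N ≤ Real.exp (-(s * w) + s ^ 2 * M ^ 2 / 2) := by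
    calc (∑ i, Real.exp (-(s * a i))) / N
        ≤ (∑ i, (1 - s * a i + s ^ 2 * M ^ 2 / 2)) / N := by
          gcongr with i
          refine (exp_neg_le_quadratic (mul_nonneg hs0 (h0 i))).trans ?_
          rw [mul_pow]
          have := pow_le_pow_left₀ (h0 i) (hle i) 2
          gcongr
      _ = -(s * w) + s ^ 2 * M ^ 2 / 2 + 1 := by
          rw [Finset.sum_add_distrib, Finset.sum_sub_distrib, ← Finset.mul_sum, hw]
          simp only [Finset.sum_const, Finset.card_univ, nsmul_eq_mul, ← hN]
          field_simp
          ring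
      _ ≤ _ := Real.add_one_le_exp _
  have hmean0 : 0 ≤ (∑ i, Real.exp (-(s * a i))) / N := by positivity
  set P := (Finset.univ : Finset ι).powersetCard k with hP
  have hmac := sum_powersetCard_prod_le (z := fun i => Real.exp (-(s * a i)))
    (fun i => (Real.exp_pos _).le) k
  calc ((P.filter fun S => ∑ i ∈ S, a i ≤ k * (w - t)).card : ℝ)
      = ∑ S ∈ P.filter fun S => ∑ i ∈ S, a i ≤ k * (w - t), (1 : ℝ) := by simp
    _ ≤ ∑ S ∈ P.filter fun S => ∑ i ∈ S, a i ≤ k * (w - t),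
          Real.exp (s * (k * (w - t))) * ∏ i ∈ S, Real.exp (-(s * a i)) := by
        refine Finset.sum_le_sum fun S hS => ?_
        rw [← Real.exp_sum, ← Real.exp_add, Finset.sum_neg_distrib, ← Finset.mul_sum]
        refine Real.one_le_exp ?_
        have := mul_le_mul_of_nonneg_left (Finset.mem_filter.1 hS).2 hs0
        linarith
    _ ≤ ∑ S ∈ P, Real.exp (s * (k * (w - t))) * ∏ i ∈ S, Real.exp (-(s * a i)) :=
        Finset.sum_le_sum_of_subset_of_nonneg (Finset.filter_subset _ _)
          fun S _ _ => by positivity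
    _ ≤ Real.exp (s * (k * (w - t)))
          * ((Fintype.card ι).choose k * ((∑ i, Real.exp (-(s * a i))) / N) ^ k) := by
        rw [← Finset.mul_sum]
        gcongr
    _ ≤ Real.exp (s * (k * (w - t)))
          * ((Fintype.card ι).choose k * Real.exp (-(s * w) + s ^ 2 * M ^ 2 / 2) ^ k) := by
        gcongr
    _ = (Fintype.card ι).choose k * Real.exp (-(k * t ^ 2 / (2 * M ^ 2))) := by
        rw [← Real.exp_nat_mul, mul_left_comm, ← Real.exp_add]
        congr 2
        rw [hs]
        field_simp
        ring

/-! ### The law of a single bag -/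

lemma bagFamilies_nonempty {n m k : ℕ} (h : m * k ≤ n) : (bagFamilies n m k).Nonempty := by
  have hcard : Fintype.card (Fin m × Fin k) ≤ Fintype.card (Fin n) := by simpa using h
  obtain ⟨f⟩ := Function.Embedding.nonempty_of_card_le hcard
  refine ⟨fun j => Finset.univ.map ⟨fun i => f (j, i), fun a b hab => ?_⟩, fun j => by simp, ?_⟩
  · simpa using f.injective hab
  · intro j j' hjj'
    rw [Finset.disjoint_left]
    intro a ha ha'
    simp only [Finset.mem_map, Finset.mem_univ, true_and] at ha ha'
    obtain ⟨i, rfl⟩ := ha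
    obtain ⟨i', hi'⟩ := ha'
    exact hjj' (Prod.ext_iff.1 (f.injective hi')).1.symm

lemma exists_perm_map_eq {ι : Type*} [Fintype ι] [DecidableEq ι] {T T' : Finset ι}
    (h : T.card = T'.card) : ∃ σ : Equiv.Perm ι, T.map σ.toEmbedding = T' := by
  let e : {x // x ∈ T} ≃ {x // x ∈ T'} := Finset.equivOfCardEq h
  refine ⟨e.extendSubtype, Finset.eq_of_subset_of_card_le ?_ (by simp [h])⟩
  intro x hx
  obtain ⟨y, hy, rfl⟩ := Finset.mem_map.1 hx
  exact e.extendSubtype_mem y hy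

lemma map_mem_bagFamilies {n m k : ℕ} (σ : Equiv.Perm (Fin n)) {S : Fin m → Finset (Fin n)}
    (hS : S ∈ bagFamilies n m k) : (fun j => (S j).map σ.toEmbedding) ∈ bagFamilies n m k :=
  ⟨fun j => by simpa using hS.1 j, fun _ _ h => (Finset.disjoint_map _).2 (hS.2 h)⟩

open Classical in
/-- Permutations of the index set act on the families of bags, so any two `k`-subsets are the
`j`-th bag of equally many families. -/
lemma card_bagFamilies_fiber_eq {n m k : ℕ} (j : Fin m) {T T' : Finset (Fin n)}
    (h : T.card = T'.card) :
    ((Finset.univ.filter (· ∈ bagFamilies n m k)).filter (fun S => S j = T)).card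
      = ((Finset.univ.filter (· ∈ bagFamilies n m k)).filter (fun S => S j = T')).card := by
  have key : ∀ {T T' : Finset (Fin n)}, T.card = T'.card →
      ((Finset.univ.filter (· ∈ bagFamilies n m k)).filter (fun S => S j = T)).card
        ≤ ((Finset.univ.filter (· ∈ bagFamilies n m k)).filter (fun S => S j = T')).card := by
    intro T T' h
    obtain ⟨σ, rfl⟩ := exists_perm_map_eq h
    refine Finset.card_le_card_of_injOn (fun S i => (S i).map σ.toEmbedding) ?_ ?_
    · intro S hS
      simp only [Finset.coe_filter, Finset.mem_filter, Finset.mem_univ, true_and,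
        Set.mem_ofPred_eq] at hS ⊢
      exact ⟨map_mem_bagFamilies σ hS.1, by rw [hS.2]⟩
    · intro S _ S' _ hSS'
      funext i
      exact Finset.map_injective _ (congrFun hSS' i)
  exact le_antisymm (key h) (key h.symm)

open Classical in
/-- Each bag is a uniformly random `k`-subset: a bound on the proportion of bad `k`-subsets
bounds the probability that the `j`-th bag is bad. -/
theorem bagLaw_real_le_of_card_le {n m k : ℕ} (h : m * k ≤ n) (j : Fin m)
    (p : Finset (Fin n) → Prop) {q : ℝ}
    (hp : (((Finset.univ : Finset (Fin n)).powersetCard k).filter p).card ≤ n.choose k * q) :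
    (bagLaw n m k).real {S | p (S j)} ≤ q := by
  set F := Finset.univ.filter (· ∈ bagFamilies n m k) with hF
  set P := (Finset.univ : Finset (Fin n)).powersetCard k with hP
  obtain ⟨S₀, hS₀⟩ := bagFamilies_nonempty h
  have hmaps : ∀ S ∈ F, S j ∈ P := fun S hS =>
    Finset.mem_powersetCard.2 ⟨Finset.subset_univ _, (Finset.mem_filter.1 hS).2.1 j⟩
  set N := (F.filter fun S => S j = S₀ j).card with hN
  have hfib : ∀ T ∈ P, (F.filter fun S => S j = T).card = N := fun T hT =>
    card_bagFamilies_fiber_eq j ((Finset.mem_powersetCard.1 hT).2.trans (hS₀.1 j).symm)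
  have hFcard : F.card = n.choose k * N := by
    rw [Finset.card_eq_sum_card_fiberwise hmaps, Finset.sum_congr rfl hfib, Finset.sum_const,
      smul_eq_mul, hP, Finset.card_powersetCard, Finset.card_univ, Fintype.card_fin]
  have hFpcard : (F.filter fun S => p (S j)).card = (P.filter p).card * N := by
    have hmaps' : ∀ S ∈ F.filter fun S => p (S j), S j ∈ P.filter p := fun S hS =>
      Finset.mem_filter.2 ⟨hmaps S (Finset.mem_filter.1 hS).1, (Finset.mem_filter.1 hS).2⟩
    rw [Finset.card_eq_sum_card_fiberwise hmaps', Finset.sum_congr rfl (g := fun _ => N),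
      Finset.sum_const, smul_eq_mul]
    intro T hT
    rw [← hfib T (Finset.mem_filter.1 hT).1, Finset.filter_filter]
    congr 1
    refine Finset.filter_congr fun S _ => ⟨fun hS => hS.2, fun hS => ⟨?_, hS⟩⟩
    rw [hS]
    exact (Finset.mem_filter.1 hT).2
  have hFpos : (0 : ℝ) < F.card :=
    Nat.cast_pos.2 (Finset.card_pos.2 ⟨S₀, Finset.mem_filter.2 ⟨Finset.mem_univ _, hS₀⟩⟩)
  have hFcoe : bagFamilies n m k = (F : Set (Fin m → Finset (Fin n))) := by simp [hF]
  have hset : {S : Fin m → Finset (Fin n) | p (S j)}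
      = ((Finset.univ.filter fun S : Fin m → Finset (Fin n) => p (S j) : Finset _) : Set _) := by
    simp
  have hinter : F ∩ Finset.univ.filter (fun S : Fin m → Finset (Fin n) => p (S j))
      = F.filter fun S => p (S j) := by
    rw [Finset.inter_filter, Finset.inter_univ]
  rw [bagLaw, hFcoe, hset, measureReal_def, uniformOn_apply_finset, ENNReal.toReal_div,
    ENNReal.toReal_natCast, ENNReal.toReal_natCast, div_le_iff₀ hFpos, hinter]
  rw [hFpcard, hFcard]
  push_cast
  calc ((P.filter p).card : ℝ) * N ≤ (n.choose k * q) * N :=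
        mul_le_mul_of_nonneg_right hp (Nat.cast_nonneg N)
    _ = q * (n.choose k * N) := by ring

/-! ### Nets of a Euclidean ball -/

/-- The volumetric bound for separated sets: the balls of radius `ε / 2` around the points are
disjoint and lie in the ball of radius `R + ε / 2`. -/
lemma card_le_of_separated {E : Type*} [NormedAddCommGroup E] [NormedSpace ℝ E]
    [FiniteDimensional ℝ E] {R ε : ℝ} (hR : 0 ≤ R) (hε : 0 < ε) (s : Finset E)
    (hs : ∀ c ∈ s, ‖c‖ ≤ R) (h : ∀ c ∈ s, ∀ e ∈ s, c ≠ e → ε ≤ ‖c - e‖) :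
    (s.card : ℝ) ≤ (1 + 2 * R / ε) ^ Module.finrank ℝ E := by
  borelize E
  let μ : Measure E := Measure.addHaar
  have hδ : 0 < ε / 2 := by positivity
  have hρ : 0 < R + ε / 2 := by positivity
  have hdisj : (s : Set E).PairwiseDisjoint fun c => Metric.ball c (ε / 2) := by
    intro c hc e he hce
    apply Metric.ball_disjoint_ball
    rw [dist_eq_norm, add_halves]
    exact h c hc e he hce
  have hsub : ⋃ c ∈ s, Metric.ball c (ε / 2) ⊆ Metric.ball (0 : E) (R + ε / 2) := by
    refine Set.iUnion₂_subset fun x hx => Metric.ball_subset_ball' ?_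
    rw [dist_zero_right]
    linarith [hs x hx]
  have hvol : (s.card : ENNReal) * ENNReal.ofReal ((ε / 2) ^ Module.finrank ℝ E)
        * μ (Metric.ball 0 1)
      ≤ ENNReal.ofReal ((R + ε / 2) ^ Module.finrank ℝ E) * μ (Metric.ball 0 1) := by
    calc (s.card : ENNReal) * ENNReal.ofReal ((ε / 2) ^ Module.finrank ℝ E)
          * μ (Metric.ball 0 1)
        = μ (⋃ c ∈ s, Metric.ball c (ε / 2)) := by
          rw [measure_biUnion_finset hdisj fun c _ => measurableSet_ball]
          simp only [μ.addHaar_ball_of_pos _ hδ, Finset.sum_const, nsmul_eq_mul, mul_assoc]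
      _ ≤ μ (Metric.ball (0 : E) (R + ε / 2)) := measure_mono hsub
      _ = _ := μ.addHaar_ball_of_pos _ hρ
  have hcancel := (ENNReal.mul_le_mul_iff_left
    (Metric.measure_ball_pos _ _ zero_lt_one).ne' measure_ball_lt_top.ne).1 hvol
  have hreal := ENNReal.toReal_le_of_le_ofReal (pow_nonneg hρ.le _) hcancel
  rw [ENNReal.toReal_mul, ENNReal.toReal_natCast, ENNReal.toReal_ofReal (by positivity),
    ← le_div_iff₀ (by positivity), ← div_pow] at hreal
  refine hreal.trans_eq ?_
  congr 1
  field_simp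
  ring

/-- A ball of radius `R` has an `ε`-net of the volumetric size, namely a maximal separated set. -/
theorem exists_net_closedBall {E : Type*} [NormedAddCommGroup E] [NormedSpace ℝ E]
    [FiniteDimensional ℝ E] {R ε : ℝ} (hR : 0 ≤ R) (hε : 0 < ε) :
    ∃ s : Finset E, (∀ c ∈ s, ‖c‖ ≤ R) ∧ (∀ x, ‖x‖ ≤ R → ∃ c ∈ s, ‖x - c‖ ≤ ε) ∧
      (s.card : ℝ) ≤ (1 + 2 * R / ε) ^ Module.finrank ℝ E := by
  classical
  let sep : Finset E → Prop := fun s =>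
    (∀ c ∈ s, ‖c‖ ≤ R) ∧ ∀ c ∈ s, ∀ e ∈ s, c ≠ e → ε ≤ ‖c - e‖
  -- the volumetric bound allows a separated set of largest cardinality
  let b : ℕ := ⌊(1 + 2 * R / ε) ^ Module.finrank ℝ E⌋₊
  have hb : ∀ l, (∃ s, sep s ∧ s.card = l) → l ≤ b := by
    rintro l ⟨s, hs, rfl⟩
    exact Nat.le_floor (card_le_of_separated hR hε s hs.1 hs.2)
  have hex : ∃ s, sep s ∧ s.card = Nat.findGreatest (fun l => ∃ s, sep s ∧ s.card = l) b :=
    Nat.findGreatest_spec (P := fun l => ∃ s, sep s ∧ s.card = l) (Nat.zero_le b)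
      ⟨∅, ⟨by simp, by simp⟩, rfl⟩
  obtain ⟨s, hs, hcard⟩ := hex
  refine ⟨s, hs.1, fun x hx => ?_, card_le_of_separated hR hε s hs.1 hs.2⟩
  by_contra! hfar
  have hxs : x ∉ s := fun hxs => by
    have := hfar x hxs
    rw [sub_self, norm_zero] at this
    linarith
  have hins : sep (insert x s) := by
    refine ⟨fun c hc => ?_, fun c hc e he hce => ?_⟩
    · rcases Finset.mem_insert.1 hc with rfl | hc
      exacts [hx, hs.1 c hc]
    · rcases Finset.mem_insert.1 hc with rfl | hc' <;> rcases Finset.mem_insert.1 he with rfl | he'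
      · exact absurd rfl hce
      · exact (hfar e he').le
      · rw [norm_sub_rev]
        exact (hfar c hc').le
      · exact hs.2 c hc' e he' hce
  have hmax := Nat.le_findGreatest (P := fun l => ∃ s, sep s ∧ s.card = l)
    (hb _ ⟨_, hins, rfl⟩) ⟨_, hins, rfl⟩
  rw [Finset.card_insert_of_notMem hxs, ← hcard] at hmax
  omega

namespace RegressionData

variable {n d : ℕ} (D : RegressionData n d)

/-! ### The second-moment matrix -/

lemma Q_mulVec_apply (v : EuclideanSpace ℝ (Fin d)) (a : Fin d) :
    (D.Q.mulVec v.ofLp) a = (n : ℝ)⁻¹ * ∑ i, inner ℝ v (D.x i) * D.x i a := by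
  simp only [Q, Matrix.smul_mulVec, Matrix.sum_mulVec, Pi.smul_apply, Finset.sum_apply,
    smul_eq_mul, Matrix.vecMulVec_mulVec]
  congr 1
  refine Finset.sum_congr rfl fun i _ => ?_
  simp [PiLp.inner_apply, dotProduct, mul_comm]

lemma sum_inner_mul_inner_of_mulVec_eq (hn : 0 < n) {v : EuclideanSpace ℝ (Fin d)} {μ : ℝ}
    (h : D.Q.mulVec v.ofLp = μ • v.ofLp) (w : EuclideanSpace ℝ (Fin d)) :
    ∑ i, inner ℝ v (D.x i) * inner ℝ w (D.x i) = n * (μ * inner ℝ v w) := by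
  have hn' : (n : ℝ) ≠ 0 := by positivity
  have key : ∀ a, ∑ i, inner ℝ v (D.x i) * D.x i a = n * (μ * v a) := by
    intro a
    have ha := congrFun h a
    rw [Q_mulVec_apply, Pi.smul_apply, smul_eq_mul] at ha
    rw [← ha]
    field_simp
  calc ∑ i, inner ℝ v (D.x i) * inner ℝ w (D.x i)
      = ∑ i, ∑ a, w a * (inner ℝ v (D.x i) * D.x i a) := by
        refine Finset.sum_congr rfl fun i _ => ?_
        rw [PiLp.inner_apply w, Finset.mul_sum]
        refine Finset.sum_congr rfl fun a _ => ?_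
        simp only [RCLike.inner_apply, conj_trivial]
        ring
    _ = ∑ a, w a * (n * (μ * v a)) := by
        rw [Finset.sum_comm]
        refine Finset.sum_congr rfl fun a _ => ?_
        rw [← Finset.mul_sum, key]
    _ = n * (μ * inner ℝ v w) := by
        rw [PiLp.inner_apply, Finset.mul_sum, Finset.mul_sum]
        refine Finset.sum_congr rfl fun a _ => ?_
        simp only [RCLike.inner_apply, conj_trivial]
        ring

lemma isHermitian_Q : D.Q.IsHermitian := by
  rw [Matrix.IsHermitian, Matrix.conjTranspose_eq_transpose_of_trivial]
  ext a b
  simp only [Q, Matrix.transpose_apply, Matrix.smul_apply, Matrix.sum_apply,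
    Matrix.vecMulVec_apply, mul_comm]

variable {D}

lemma IsMinNonzeroEigenvalue.pos_and_le_sq {lam B₂ : ℝ} (hn : 0 < n)
    (h : D.IsMinNonzeroEigenvalue lam) (hx : ∀ i, ‖D.x i‖ ≤ B₂) : 0 < lam ∧ lam ≤ B₂ ^ 2 := by
  obtain ⟨⟨hne, hev⟩, -⟩ := h
  obtain ⟨v, hv⟩ := hev.exists_hasEigenvector
  let u : EuclideanSpace ℝ (Fin d) := WithLp.toLp 2 v
  have hu : D.Q.mulVec u.ofLp = lam • u.ofLp := by
    have := hv.apply_eq_smul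
    rwa [Matrix.toLin'_apply] at this
  have hu0 : u ≠ 0 := fun h0 => hv.2 (by simpa [u] using congrArg WithLp.ofLp h0)
  have hupos : 0 < ‖u‖ ^ 2 := by positivity
  have hn' : (0 : ℝ) < n := Nat.cast_pos.2 hn
  have hsum := D.sum_inner_mul_inner_of_mulVec_eq hn hu u
  rw [real_inner_self_eq_norm_sq] at hsum
  constructor
  · refine lt_of_le_of_ne ?_ hne.symm
    have h0 : 0 ≤ n * (lam * ‖u‖ ^ 2) := by
      rw [← hsum]
      exact Finset.sum_nonneg fun i _ => mul_self_nonneg _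
    exact nonneg_of_mul_nonneg_left (nonneg_of_mul_nonneg_right h0 hn') hupos
  · have hle : n * (lam * ‖u‖ ^ 2) ≤ n * (B₂ ^ 2 * ‖u‖ ^ 2) := by
      rw [← hsum]
      calc ∑ i, inner ℝ u (D.x i) * inner ℝ u (D.x i) ≤ ∑ _i : Fin n, B₂ ^ 2 * ‖u‖ ^ 2 := by
            refine Finset.sum_le_sum fun i _ => ?_
            rw [← pow_two, ← sq_abs, ← mul_pow]
            refine pow_le_pow_left₀ (abs_nonneg _) ((abs_real_inner_le_norm u (D.x i)).trans ?_) 2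
            rw [mul_comm]
            gcongr
            exact hx i
        _ = n * (B₂ ^ 2 * ‖u‖ ^ 2) := by simp
    exact le_of_mul_le_mul_right (le_of_mul_le_mul_left hle hn') hupos

/-- Every regressor can be replaced by its projection to the range of `Q`, which has the same
predictions and on which the quadratic form of `Q` is at least `lam` times the squared norm. -/
lemma IsMinNonzeroEigenvalue.exists_inner_eq_and_le {lam : ℝ} (hn : 0 < n)
    (h : D.IsMinNonzeroEigenvalue lam) (r : EuclideanSpace ℝ (Fin d)) :
    ∃ r' : EuclideanSpace ℝ (Fin d), (∀ i, inner ℝ r' (D.x i) = inner ℝ r (D.x i)) ∧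
      n * (lam * ‖r'‖ ^ 2) ≤ ∑ i, inner ℝ r' (D.x i) ^ 2 := by
  classical
  have hn' : (0 : ℝ) < n := Nat.cast_pos.2 hn
  let b := D.isHermitian_Q.eigenvectorBasis
  let μ := D.isHermitian_Q.eigenvalues
  have hb : ∀ j, D.Q.mulVec (b j).ofLp = μ j • (b j).ofLp :=
    D.isHermitian_Q.mulVec_eigenvectorBasis
  have hform := fun j w => D.sum_inner_mul_inner_of_mulVec_eq hn (hb j) w
  have hzero : ∀ j, μ j = 0 → ∀ i, inner ℝ (b j) (D.x i) = 0 := by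
    intro j hj i
    have := hform j (b j)
    rw [hj, zero_mul, mul_zero, Finset.sum_eq_zero_iff_of_nonneg fun i _ => mul_self_nonneg _]
      at this
    exact mul_self_eq_zero.1 (this i (Finset.mem_univ i))
  have hlam : ∀ j, μ j ≠ 0 → lam ≤ μ j := by
    intro j hj
    refine h.2 ⟨hj, Module.End.hasEigenvalue_of_hasEigenvector (x := (b j).ofLp)
      ⟨Module.End.mem_eigenspace_iff.2 (by rw [Matrix.toLin'_apply, hb]), fun h0 => ?_⟩⟩
    exact b.orthonormal.ne_zero j (by ext a; simpa using congrFun h0 a)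
  let J : Finset (Fin d) := Finset.univ.filter fun j => μ j ≠ 0
  let r' : EuclideanSpace ℝ (Fin d) := ∑ j ∈ J, inner ℝ (b j) r • b j
  have hr'inner : ∀ w, inner ℝ r' w = ∑ j ∈ J, inner ℝ (b j) r * inner ℝ (b j) w := by
    intro w
    simp only [r', sum_inner, real_inner_smul_left]
  have hcoef : ∀ j ∈ J, inner ℝ (b j) r' = inner ℝ (b j) r := by
    intro j hj
    rw [real_inner_comm, hr'inner, Finset.sum_eq_single_of_mem j hj]
    · simp
    · intro l _ hl
      rw [b.inner_eq_zero hl, mul_zero]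
  refine ⟨r', fun i => ?_, ?_⟩
  · rw [hr'inner, ← b.sum_inner_mul_inner]
    refine Finset.sum_subset_zero_on_sdiff (Finset.subset_univ J) (fun j hj => ?_) fun j _ => ?_
    · have hj0 : μ j = 0 := by simpa [J] using hj
      rw [hzero j hj0, mul_zero]
    · rw [real_inner_comm]
  · have hsq : ∑ i, inner ℝ r' (D.x i) ^ 2 = n * ∑ j ∈ J, μ j * inner ℝ (b j) r ^ 2 := by
      calc ∑ i, inner ℝ r' (D.x i) ^ 2
          = ∑ i, ∑ j ∈ J, inner ℝ (b j) r * (inner ℝ (b j) (D.x i) * inner ℝ r' (D.x i)) := by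
            refine Finset.sum_congr rfl fun i _ => ?_
            rw [pow_two]
            nth_rewrite 1 [hr'inner]
            rw [Finset.sum_mul]
            exact Finset.sum_congr rfl fun j _ => mul_assoc _ _ _
        _ = ∑ j ∈ J, inner ℝ (b j) r * (n * (μ j * inner ℝ (b j) r)) := by
            rw [Finset.sum_comm]
            refine Finset.sum_congr rfl fun j hj => ?_
            rw [← Finset.mul_sum, hform, hcoef j hj]
        _ = _ := by
            rw [Finset.mul_sum]
            exact Finset.sum_congr rfl fun j _ => by ring
    have hnorm : ‖r'‖ ^ 2 = ∑ j ∈ J, inner ℝ (b j) r ^ 2 := by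
      rw [← real_inner_self_eq_norm_sq, hr'inner]
      exact Finset.sum_congr rfl fun j hj => by rw [hcoef j hj, pow_two]
    rw [hsq, hnorm, Finset.mul_sum]
    gcongr with j hj
    exact hlam j (Finset.mem_filter.1 hj).2

/-! ### The loss of a bag -/

variable (D)

lemma loss_le_loss_add {B₁ B₂ R ε : ℝ} (hy : ∀ i, |D.y i| ≤ B₁) (hx : ∀ i, ‖D.x i‖ ≤ B₂)
    {r r' : EuclideanSpace ℝ (Fin d)} (hr : ‖r‖ ≤ R) (hr' : ‖r'‖ ≤ R) (hε : ‖r - r'‖ ≤ ε)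
    (T : Finset (Fin n)) :
    D.loss T r' ≤ D.loss T r + T.card * (ε * B₂ * (2 * (B₁ + R * B₂))) := by
  rw [loss, loss, ← nsmul_eq_mul, ← Finset.sum_const, ← Finset.sum_add_distrib]
  refine Finset.sum_le_sum fun i _ => ?_
  have hB₂ : 0 ≤ B₂ := (norm_nonneg _).trans (hx i)
  have hbound : ∀ s : EuclideanSpace ℝ (Fin d), ∀ {ρ : ℝ}, ‖s‖ ≤ ρ →
      |inner ℝ s (D.x i)| ≤ ρ * B₂ := fun s ρ hs =>
    (abs_real_inner_le_norm s (D.x i)).trans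
      (mul_le_mul hs (hx i) (norm_nonneg _) ((norm_nonneg _).trans hs))
  have h1 := hbound (r - r') hε
  have h2 := abs_le.1 (hbound r hr)
  have h3 := abs_le.1 (hbound r' hr')
  have h4 := abs_le.1 (hy i)
  have h5 : |2 * D.y i - inner ℝ r (D.x i) - inner ℝ r' (D.x i)| ≤ 2 * (B₁ + R * B₂) :=
    abs_le.2 ⟨by linarith, by linarith⟩
  have h6 := mul_le_mul h1 h5 (abs_nonneg _) ((abs_nonneg _).trans h1)
  rw [← abs_mul, inner_sub_left] at h6
  have h7 := (le_abs_self _).trans h6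
  linarith

lemma loss_smul_le {τ : ℝ} (h0 : 0 ≤ τ) (h1 : τ ≤ 1) (T : Finset (Fin n))
    (r : EuclideanSpace ℝ (Fin d)) :
    D.loss T (τ • r) ≤ (1 - τ) * D.loss T 0 + τ * D.loss T r := by
  rw [loss, loss, loss, Finset.mul_sum, Finset.mul_sum, ← Finset.sum_add_distrib]
  refine Finset.sum_le_sum fun i _ => ?_
  rw [real_inner_smul_left, inner_zero_left]
  nlinarith [mul_nonneg (mul_nonneg h0 (sub_nonneg.2 h1)) (sq_nonneg (inner ℝ r (D.x i)))]

lemma loss_zero_le {B₁ : ℝ} (hy : ∀ i, |D.y i| ≤ B₁) (T : Finset (Fin n)) :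
    D.loss T 0 ≤ T.card * B₁ ^ 2 := by
  rw [loss, ← nsmul_eq_mul, ← Finset.sum_const]
  refine Finset.sum_le_sum fun i _ => ?_
  rw [inner_zero_left, sub_zero, ← sq_abs]
  exact pow_le_pow_left₀ (abs_nonneg _) (hy i) 2

lemma opt_le_loss (r : EuclideanSpace ℝ (Fin d)) : D.opt ≤ D.loss Finset.univ r :=
  ciInf_le ⟨0, by rintro _ ⟨s, rfl⟩; exact Finset.sum_nonneg fun i _ => sq_nonneg _⟩ r

lemma le_loss_of_sum_inner_sq_ge {B₁ q : ℝ} (hy : ∀ i, |D.y i| ≤ B₁)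
    {r : EuclideanSpace ℝ (Fin d)} (hq : n * q ≤ ∑ i, inner ℝ r (D.x i) ^ 2) :
    n * (q / 2 - B₁ ^ 2) ≤ D.loss Finset.univ r := by
  have h : ∑ i, (inner ℝ r (D.x i) ^ 2 / 2 - B₁ ^ 2) ≤ D.loss Finset.univ r := by
    refine Finset.sum_le_sum fun i _ => ?_
    have := pow_le_pow_left₀ (abs_nonneg _) (hy i) 2
    rw [sq_abs] at this
    nlinarith [sq_nonneg (inner ℝ r (D.x i) - 2 * D.y i)]
  rw [Finset.sum_sub_distrib, ← Finset.sum_div] at h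
  simp only [Finset.sum_const, Finset.card_univ, Fintype.card_fin, nsmul_eq_mul] at h
  linarith

variable {D}

/-- If the loss of a bag is not much below its mean at the points of a net of the ball of radius
`R = B₁ √(6 / lam)`, then the bag is not fitted well by any regressor. Inside the ball the loss is
Lipschitz. On the sphere it exceeds its value at `0`, so by convexity along rays it also does so
outside the ball. -/
theorem le_loss_of_net {B₁ B₂ γ lam R ε : ℝ} (hn : 0 < n) (hy : ∀ i, |D.y i| ≤ B₁)
    (hx : ∀ i, ‖D.x i‖ ≤ B₂) (hlam : D.IsMinNonzeroEigenvalue lam) (hγ : 0 < γ)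
    (hγB : γ ≤ B₁ ^ 2) (hopt : γ * n ≤ D.opt) (hR : 0 < R) (hRlam : R ^ 2 * lam = 6 * B₁ ^ 2)
    (hlip : ε * B₂ * (2 * (B₁ + R * B₂)) ≤ γ / 8) {s : Finset (EuclideanSpace ℝ (Fin d))}
    (hsR : ∀ c ∈ s, ‖c‖ ≤ R) (hs : ∀ r, ‖r‖ ≤ R → ∃ c ∈ s, ‖r - c‖ ≤ ε) {T : Finset (Fin n)}
    (hT : ∀ c ∈ s, T.card * (D.loss Finset.univ c / n - γ / 2) ≤ D.loss T c)
    (r : EuclideanSpace ℝ (Fin d)) : T.card * γ / 4 ≤ D.loss T r := by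
  have hn' : (0 : ℝ) < n := Nat.cast_pos.2 hn
  have hcard : (0 : ℝ) ≤ T.card := Nat.cast_nonneg _
  have hball : ∀ r, ‖r‖ ≤ R →
      T.card * (D.loss Finset.univ r / n - 3 * γ / 4) ≤ D.loss T r := by
    intro r hr
    obtain ⟨c, hc, hrc⟩ := hs r hr
    have h1 := D.loss_le_loss_add hy hx hr (hsR c hc) hrc T
    have h2 := D.loss_le_loss_add hy hx (hsR c hc) hr ((norm_sub_rev c r).trans_le hrc)
      Finset.univ
    rw [Finset.card_univ, Fintype.card_fin] at h2
    have h3 : D.loss Finset.univ r / n ≤ D.loss Finset.univ c / n + γ / 8 := by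
      rw [div_add' _ _ _ hn'.ne']
      gcongr
      linarith [mul_le_mul_of_nonneg_left hlip hn'.le]
    have h4 := mul_le_mul_of_nonneg_left hlip hcard
    have h5 := mul_le_mul_of_nonneg_left h3 hcard
    have h6 := hT c hc
    linarith
  obtain ⟨r', hr', hquad⟩ := hlam.exists_inner_eq_and_le hn r
  have hloss : D.loss T r = D.loss T r' := by simp only [loss, hr']
  rw [hloss]
  rcases le_or_gt ‖r'‖ R with hle | hgt
  · have h1 : γ ≤ D.loss Finset.univ r' / n := by
      rw [le_div_iff₀ hn']
      exact hopt.trans (D.opt_le_loss r')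
    have h2 := mul_le_mul_of_nonneg_left h1 hcard
    have h3 := hball r' hle
    linarith
  · have hpos : 0 < ‖r'‖ := hR.trans hgt
    set τ : ℝ := R / ‖r'‖ with hτ
    have hτ0 : 0 < τ := by positivity
    have hτ1 : τ ≤ 1 := (div_le_one hpos).2 hgt.le
    have hτr : τ * ‖r'‖ = R := by rw [hτ]; field_simp
    have hnorm : ‖τ • r'‖ = R := by rw [norm_smul, Real.norm_of_nonneg hτ0.le, hτr]
    have hq : n * (6 * B₁ ^ 2) ≤ ∑ i, inner ℝ (τ • r') (D.x i) ^ 2 := by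
      calc n * (6 * B₁ ^ 2) = τ ^ 2 * (n * (lam * ‖r'‖ ^ 2)) := by rw [← hRlam, ← hτr]; ring
        _ ≤ τ ^ 2 * ∑ i, inner ℝ r' (D.x i) ^ 2 := by gcongr
        _ = _ := by
          rw [Finset.mul_sum]
          exact Finset.sum_congr rfl fun i _ => by rw [real_inner_smul_left, mul_pow]
    have h1 : 2 * B₁ ^ 2 ≤ D.loss Finset.univ (τ • r') / n := by
      rw [le_div_iff₀ hn']
      linarith [D.le_loss_of_sum_inner_sq_ge hy hq]
    have h2 : T.card * B₁ ^ 2 ≤ D.loss T (τ • r') :=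
      (mul_le_mul_of_nonneg_left (by linarith) hcard).trans (hball _ hnorm.le)
    have h3 := D.loss_smul_le hτ0.le hτ1 T r'
    have h4 := mul_le_mul_of_nonneg_left (D.loss_zero_le hy T) (sub_nonneg.2 hτ1)
    have h5 : T.card * B₁ ^ 2 ≤ D.loss T r' := by
      refine le_of_mul_le_mul_left (a := τ) ?_ hτ0
      linarith
    have h6 := mul_le_mul_of_nonneg_left hγB hcard
    have h7 := mul_nonneg hcard hγ.le
    linarith

end RegressionData

namespace RegressionData

variable {n d : ℕ} {D : RegressionData n d}

/-! ### The probability of a bad bag -/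

lemma IsMinNonzeroEigenvalue.card_pos {lam : ℝ} (h : D.IsMinNonzeroEigenvalue lam) : 0 < n := by
  rcases Nat.eq_zero_or_pos n with rfl | hn
  · obtain ⟨v, hv⟩ := h.1.2.exists_hasEigenvector
    have hv' := hv.apply_eq_smul
    have hQ : D.Q = 0 := by simp [Q]
    rw [hQ, map_zero, LinearMap.zero_apply, eq_comm, smul_eq_zero] at hv'
    exact (hv'.elim h.1.1 hv.2).elim
  · exact hn

lemma le_sq_of_mul_le_opt {B₁ γ : ℝ} (hn : 0 < n) (hy : ∀ i, |D.y i| ≤ B₁)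
    (hopt : γ * n ≤ D.opt) : γ ≤ B₁ ^ 2 := by
  have h := hopt.trans ((D.opt_le_loss 0).trans (D.loss_zero_le hy Finset.univ))
  rw [Finset.card_univ, Fintype.card_fin, mul_comm] at h
  exact le_of_mul_le_mul_left h (Nat.cast_pos.2 hn)

open Classical in
/-- The number of `k`-subsets on which some regressor has small loss, by a union bound over a net
of at most `exp (6 d log (3 B₁² B₂² / (γ lam)))` regressors. -/
theorem card_filter_exists_loss_lt_le {B₁ B₂ γ lam : ℝ} (k : ℕ) (hy : ∀ i, |D.y i| ≤ B₁)
    (hx : ∀ i, ‖D.x i‖ ≤ B₂) (hlam : D.IsMinNonzeroEigenvalue lam) (hγ : 0 < γ)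
    (hopt : γ * n ≤ D.opt) :
    ((((Finset.univ : Finset (Fin n)).powersetCard k).filter
        fun T => ∃ r, D.loss T r < k * γ / 4).card : ℝ)
      ≤ n.choose k * Real.exp (-(1 / 1568) * (k * lam ^ 2 * γ ^ 2 / (B₁ ^ 4 * B₂ ^ 4))
          + 6 * (d * Real.log (3 * B₁ ^ 2 * B₂ ^ 2 / (γ * lam)))) := by
  have hn := hlam.card_pos
  have : Nonempty (Fin n) := ⟨⟨0, hn⟩⟩
  obtain ⟨hlam0, hlamB⟩ := hlam.pos_and_le_sq hn hx
  have hγB := le_sq_of_mul_le_opt hn hy hopt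
  have hB₁ : 0 < B₁ := by
    refine lt_of_le_of_ne ((abs_nonneg _).trans (hy ⟨0, hn⟩)) ?_
    rintro rfl
    linarith
  have hB₂ : 0 < B₂ := by
    refine lt_of_le_of_ne ((norm_nonneg _).trans (hx ⟨0, hn⟩)) ?_
    rintro rfl
    linarith
  set K : ℝ := B₁ ^ 2 * B₂ ^ 2 / lam with hK
  have hK0 : 0 < K := by positivity
  have hBK : B₁ ^ 2 ≤ K := by
    rw [hK, le_div_iff₀ hlam0]
    gcongr
  set R : ℝ := Real.sqrt (6 * B₁ ^ 2 / lam) with hRdef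
  have hR : 0 < R := Real.sqrt_pos.2 (by positivity)
  have hR2 : R ^ 2 = 6 * B₁ ^ 2 / lam := Real.sq_sqrt (by positivity)
  have hRlam : R ^ 2 * lam = 6 * B₁ ^ 2 := by rw [hR2]; field_simp
  have hRK : R ^ 2 * B₂ ^ 2 = 6 * K := by rw [hR2, hK]; ring
  have hBR : B₁ ≤ R * B₂ := by
    refine le_of_sq_le_sq ?_ (by positivity)
    rw [mul_pow, hRK]
    linarith
  set ε : ℝ := γ / (32 * R * B₂ ^ 2) with hε
  have hε0 : 0 < ε := by positivity
  have hlip : ε * B₂ * (2 * (B₁ + R * B₂)) ≤ γ / 8 := by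
    calc ε * B₂ * (2 * (B₁ + R * B₂)) ≤ ε * B₂ * (2 * (R * B₂ + R * B₂)) := by gcongr
      _ = γ / 8 := by rw [hε]; field_simp; ring
  obtain ⟨s, hsR, hs, hscard⟩ :=
    exists_net_closedBall (E := EuclideanSpace ℝ (Fin d)) hR.le hε0
  rw [finrank_euclideanSpace, Fintype.card_fin] at hscard
  set X : ℝ := 3 * B₁ ^ 2 * B₂ ^ 2 / (γ * lam) with hX
  have hXK : X = 3 * (K / γ) := by rw [hX, hK]; field_simp
  have hX3 : 3 ≤ X := by
    have : 1 ≤ K / γ := (one_le_div hγ).2 (hγB.trans hBK)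
    linarith
  have hX0 : 0 < X := by linarith
  have hsX : (s.card : ℝ) ≤ Real.exp (6 * (d * Real.log X)) := by
    have h1 : 1 + 2 * R / ε ≤ X ^ 6 := by
      have h2 : 2 * R / ε = 128 * X := by
        have : 2 * R / ε = 64 * (R ^ 2 * B₂ ^ 2) / γ := by rw [hε]; field_simp; ring
        rw [this, hRK, hXK]
        ring
      have h3 : (3 : ℝ) ^ 5 ≤ X ^ 5 := by gcongr
      rw [h2, pow_succ]
      nlinarith
    calc (s.card : ℝ) ≤ (1 + 2 * R / ε) ^ d := hscard
      _ ≤ (X ^ 6) ^ d := by gcongr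
      _ = Real.exp (6 * (d * Real.log X)) := by
        rw [← pow_mul, ← Real.exp_log (pow_pos hX0 (6 * d)), Real.log_pow]
        push_cast
        ring_nf
  let q : ℝ := Real.exp (-(k * (γ / 2) ^ 2 / (2 * (14 * K) ^ 2)))
  let bad : EuclideanSpace ℝ (Fin d) → Finset (Finset (Fin n)) := fun c =>
    ((Finset.univ : Finset (Fin n)).powersetCard k).filter
      fun T => D.loss T c ≤ k * (D.loss Finset.univ c / n - γ / 2)
  have hbad : ∀ c ∈ s, ((bad c).card : ℝ) ≤ n.choose k * q := by
    intro c hc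
    have hle : ∀ i, (D.y i - inner ℝ c (D.x i)) ^ 2 ≤ 14 * K := by
      intro i
      have h1 : D.y i ^ 2 ≤ B₁ ^ 2 := sq_le_sq' (abs_le.1 (hy i)).1 (abs_le.1 (hy i)).2
      have h2 : inner ℝ c (D.x i) ^ 2 ≤ R ^ 2 * B₂ ^ 2 := by
        rw [← sq_abs, ← mul_pow]
        refine pow_le_pow_left₀ (abs_nonneg _) ((abs_real_inner_le_norm c (D.x i)).trans ?_) 2
        exact mul_le_mul (hsR c hc) (hx i) (norm_nonneg _) hR.le
      nlinarith [sq_nonneg (D.y i + inner ℝ c (D.x i))]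
    have := card_powersetCard_sum_le_le (M := 14 * K) (t := γ / 2) (by positivity)
      (fun i => sq_nonneg _) hle k (by positivity)
    rwa [Fintype.card_fin] at this
  have hsub : (((Finset.univ : Finset (Fin n)).powersetCard k).filter
      fun T => ∃ r, D.loss T r < k * γ / 4) ⊆ s.biUnion bad := by
    intro T hT
    obtain ⟨hTk, r, hr⟩ := Finset.mem_filter.1 hT
    have hcard := (Finset.mem_powersetCard.1 hTk).2
    by_contra hnot
    refine hr.not_ge ?_
    rw [← hcard]
    refine le_loss_of_net hn hy hx hlam hγ hγB hopt hR hRlam hlip hsR hs (fun c hc => ?_) r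
    by_contra! hlt
    rw [hcard] at hlt
    exact hnot (Finset.mem_biUnion.2 ⟨c, hc, Finset.mem_filter.2 ⟨hTk, hlt.le⟩⟩)
  calc _ ≤ ((s.biUnion bad).card : ℝ) := Nat.cast_le.2 (Finset.card_le_card hsub)
    _ ≤ ∑ c ∈ s, ((bad c).card : ℝ) := by exact_mod_cast Finset.card_biUnion_le
    _ ≤ ∑ _c ∈ s, n.choose k * q := Finset.sum_le_sum hbad
    _ = n.choose k * (q * s.card) := by rw [Finset.sum_const, nsmul_eq_mul]; ring
    _ ≤ n.choose k * (q * Real.exp (6 * (d * Real.log X))) := by gcongr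
    _ = _ := by
      rw [← Real.exp_add]
      congr 3
      rw [hK]
      field_simp
      ring

end RegressionData

/-! ### All bags simultaneously -/

lemma one_sub_le_bagLaw_real {n m k : ℕ} (h : m * k ≤ n) (p : Finset (Fin n) → Prop) {q : ℝ}
    (hp : ∀ j : Fin m, (bagLaw n m k).real {S | p (S j)} ≤ q) :
    1 - m * q ≤ (bagLaw n m k).real {S | ∀ j, ¬ p (S j)} := by
  have : IsProbabilityMeasure (bagLaw n m k) :=
    isProbabilityMeasure_uniformOn (Set.toFinite _) (bagFamilies_nonempty h)
  have hcover : (Set.univ : Set (Fin m → Finset (Fin n)))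
      ⊆ {S | ∀ j, ¬ p (S j)} ∪ ⋃ j, {S | p (S j)} := by
    intro S _
    by_cases hS : ∀ j, ¬ p (S j)
    · exact Or.inl hS
    · obtain ⟨j, hj⟩ := not_forall_not.1 hS
      exact Or.inr (Set.mem_iUnion.2 ⟨j, hj⟩)
  have h1 := (measureReal_mono (μ := bagLaw n m k) hcover).trans (measureReal_union_le _ _)
  rw [probReal_univ] at h1
  have h2 : (bagLaw n m k).real (⋃ j, {S | p (S j)}) ≤ m * q := by
    refine (measureReal_iUnion_fintype_le _).trans ?_
    refine (Finset.sum_le_sum fun j _ => hp j).trans_eq ?_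
    simp
  linarith

theorem mainTheorem1 :
    ∃ c C : ℝ, 0 < c ∧ 0 < C ∧
      ∀ (n d m k : ℕ) (D : RegressionData n d) (B₁ B₂ γ lam : ℝ),
        m * k ≤ n →
        (∀ i, |D.y i| ≤ B₁) →
        (∀ i, ‖D.x i‖ ≤ B₂) →
        D.IsMinNonzeroEigenvalue lam →
        0 < γ →
        γ * n ≤ D.opt →
        -- the bound for all parameters
        1 - Real.exp (-c * (k * lam ^ 2 * γ ^ 2 / (B₁ ^ 4 * B₂ ^ 4))
              + C * (d * Real.log (3 * B₁ ^ 2 * B₂ ^ 2 / (γ * lam)) + Real.log m))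
          ≤ (bagLaw n m k).real {S | ∀ j r, k * γ / 4 ≤ D.loss (S j) r} ∧
        -- the bound with `log (B₁ B₂ / (γ λ*))`
        (γ ≤ B₁ ^ 2 / 3 → γ * lam ≤ 1 →
          1 - Real.exp (-c * (k * lam ^ 2 * γ ^ 2 / (B₁ ^ 4 * B₂ ^ 4))
                + C * (d * Real.log (B₁ * B₂ / (γ * lam)) + Real.log m))
            ≤ (bagLaw n m k).real {S | ∀ j r, k * γ / 4 ≤ D.loss (S j) r}) := by
  classical
  refine ⟨1 / 1568, 24, by norm_num, by norm_num, ?_⟩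
  intro n d m k D B₁ B₂ γ lam hmk hy hx hlam hγ hopt
  have hn := hlam.card_pos
  obtain ⟨hlam0, hlamB⟩ := hlam.pos_and_le_sq hn hx
  have hγB := RegressionData.le_sq_of_mul_le_opt hn hy hopt
  have hB₁ : 0 ≤ B₁ := (abs_nonneg _).trans (hy ⟨0, hn⟩)
  have hB₂ : 0 ≤ B₂ := (norm_nonneg _).trans (hx ⟨0, hn⟩)
  have hg : 0 < γ * lam := by positivity
  set G : ℝ := k * lam ^ 2 * γ ^ 2 / (B₁ ^ 4 * B₂ ^ 4) with hG
  set X : ℝ := 3 * B₁ ^ 2 * B₂ ^ 2 / (γ * lam) with hX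
  have hlogm : 0 ≤ Real.log m := Real.log_natCast_nonneg m
  have hd : (0 : ℝ) ≤ d := Nat.cast_nonneg d
  have hX1 : 1 ≤ X := by
    rw [hX, one_le_div hg]
    nlinarith [mul_le_mul hγB hlamB hlam0.le (sq_nonneg B₁)]
  have hcore : 1 - Real.exp (-(1 / 1568) * G + (6 * (d * Real.log X) + Real.log m))
      ≤ (bagLaw n m k).real {S | ∀ j r, k * γ / 4 ≤ D.loss (S j) r} := by
    have h1 := one_sub_le_bagLaw_real hmk (fun T => ∃ r, D.loss T r < k * γ / 4) fun j =>
      bagLaw_real_le_of_card_le hmk j _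
        (RegressionData.card_filter_exists_loss_lt_le k hy hx hlam hγ hopt)
    simp only [not_exists, not_lt] at h1
    refine le_trans ?_ h1
    rw [← add_assoc, Real.exp_add _ (Real.log m), mul_comm (Real.exp _)]
    gcongr
    -- for `m = 0` this is `0 ≤ 1`, as `log 0 = 0`
    exact Real.le_exp_log _
  refine ⟨le_trans ?_ hcore, fun hγ3 hg1 => le_trans ?_ hcore⟩
  · have hlogX := mul_nonneg hd (Real.log_nonneg hX1)
    gcongr
    linarith
  · set Y : ℝ := B₁ * B₂ / (γ * lam) with hY
    have hP : 3 ≤ B₁ ^ 2 * B₂ ^ 2 / (γ * lam) := by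
      rw [le_div_iff₀ hg]
      nlinarith [mul_le_mul hγ3 hlamB hlam0.le (by positivity)]
    have hPY : B₁ ^ 2 * B₂ ^ 2 / (γ * lam) ≤ Y ^ 2 := by
      rw [hY, div_pow, mul_pow]
      gcongr
      exact pow_le_of_le_one hg.le hg1 two_ne_zero
    have hXY : X ≤ Y ^ 4 := by
      have : X = 3 * (B₁ ^ 2 * B₂ ^ 2 / (γ * lam)) := by rw [hX]; ring
      nlinarith
    have hlogXY : Real.log X ≤ 4 * Real.log Y := by
      have := Real.log_le_log (by linarith) hXY
      rwa [Real.log_pow] at this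
    have h1 := mul_le_mul_of_nonneg_left hlogXY hd
    gcongr
    linarith
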